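/- **Proposition 5.4.** Let $K$ be a field and let $\Gamma$ be a quiver such that for any two vertices $u,v$ (possibly $u=v$) there are only finitely many paths from $u$ to $v$. Let $K\Gamma$ be the path coalgebra: the $K$-vector space with basis the set of all paths of $\Gamma$ (vertices being the paths of length $0$), with comultiplication $\Delta(p)=\sum_{qr=p}q\otimes r$, and with counit $\varepsilon(p)=1$ if $p$ has length $0$ and $\varepsilon(p)=0$ otherwise. Let $C$ be a subcoalgebra of $K\Gamma$, and let $C_0$ be its coradical, i.e. the sum of all simple subcoalgebras of $C$. Then $C$ is coreflexive if and only if $C_0$ is coreflexive. Here a coalgebra $D$ over $K$ is called coreflexive if the natural embedding $D\to (D^*)^0$, $d\mapsto (f\mapsto f(d))$, is an isomorphism, where $D^*$ is the dual algebra of $D$ (with the convolution product), and, for a $K$-algebra $A$, $A^0$ is the finite dual: the space of all linear functionals on $A$ whose kernel contains a two-sided ideal of $A$ of finite codimension. -/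

import Mathlib

open scoped TensorProduct

noncomputable section

namespace PathCoalg

universe u v w

/-! ### Paths and their factorizations -/

section Splits

variable {V : Type u} [Quiver.{v} V]

/-- The list of all factorizations `p = q r` of a path `p : a ⟶ b`; the entry `⟨c, q, r⟩` stands
for `q : a ⟶ c` and `r : c ⟶ b`. -/
def splits {a : V} :
    ∀ {b : V}, Quiver.Path a b → List (Σ c : V, Quiver.Path a c × Quiver.Path c b)
  | _, .nil => [⟨a, .nil, .nil⟩]
  | b, .cons p e =>
      ⟨b, p.cons e, .nil⟩ :: (splits p).map fun x => ⟨x.1, x.2.1, x.2.2.cons e⟩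

/-- The list `splits p` consists of exactly the factorizations of `p`. -/
theorem mem_splits {a b : V} (p : Quiver.Path a b)
    (x : Σ c : V, Quiver.Path a c × Quiver.Path c b) :
    x ∈ splits p ↔ x.2.1.comp x.2.2 = p := by
  induction p with
  | nil =>
    obtain ⟨c, q, r⟩ := x
    cases r with
    | nil => simp [splits]
    | cons r e =>
      simp only [splits, List.mem_singleton, Sigma.mk.injEq, Quiver.Path.comp_cons, reduceCtorEq,
        iff_false, not_and]
      rintro rfl
      simp
  | cons p e ih =>
    obtain ⟨c, q, r⟩ := x
    cases r with
    | nil =>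
      simp only [splits, List.mem_cons, List.mem_map, Quiver.Path.comp_nil, Sigma.mk.injEq,
        heq_eq_eq, true_and, Prod.mk.injEq, and_true]
      refine or_iff_left ?_
      rintro ⟨⟨c', q', r'⟩, -, rfl, h⟩
      simp at h
    | cons r f =>
      simp only [splits, List.mem_cons, List.mem_map, Quiver.Path.comp_cons]
      constructor
      · rintro (h | ⟨⟨c', q', r'⟩, h, h'⟩)
        · simp only [Sigma.mk.injEq] at h
          obtain ⟨rfl, h⟩ := h
          simp at h
        · simp only [Sigma.mk.injEq] at h'
          obtain ⟨rfl, h'⟩ := h'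
          simp only [heq_eq_eq, Prod.mk.injEq, Quiver.Path.cons.injEq] at h'
          obtain ⟨rfl, rfl, h1, h2⟩ := h'
          obtain rfl := eq_of_heq h1
          obtain rfl := eq_of_heq h2
          rw [(ih _).1 h]
      · intro h
        simp only [Quiver.Path.cons.injEq] at h
        obtain ⟨rfl, h1, h2⟩ := h
        obtain rfl := eq_of_heq h1
        obtain rfl := eq_of_heq h2
        exact Or.inr ⟨⟨c, q, r⟩, (ih _).2 rfl, rfl⟩

/-- Every factorization of `p` occurs only once in `splits p`. -/
theorem nodup_splits {a b : V} (p : Quiver.Path a b) : (splits p).Nodup := by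
  induction p with
  | nil => simp [splits]
  | cons p e ih =>
    simp only [splits, List.nodup_cons]
    refine ⟨?_, ih.map ?_⟩
    · rintro h
      obtain ⟨⟨c', q', r'⟩, -, h'⟩ := List.mem_map.1 h
      simp only [Sigma.mk.injEq] at h'
      obtain ⟨rfl, h'⟩ := h'
      simp at h'
    · rintro ⟨c, q, r⟩ ⟨c', q', r'⟩ h
      simp only [Sigma.mk.injEq] at h
      obtain ⟨rfl, h⟩ := h
      simp_all

theorem sum_splits_assoc {M : Type*} [AddCommMonoid M] {a b : V} (p : Quiver.Path a b)
    (F : ∀ c d : V, Quiver.Path a c → Quiver.Path c d → Quiver.Path d b → M) :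
    ((splits p).map fun x => ((splits x.2.1).map fun y =>
        F y.1 x.1 y.2.1 y.2.2 x.2.2).sum).sum =
      ((splits p).map fun x => ((splits x.2.2).map fun y =>
        F x.1 y.1 x.2.1 y.2.1 y.2.2).sum).sum := by
  induction p with
  | nil => simp [splits]
  | cons p e ih =>
    have h := ih fun c d q r s => F c d q r (s.cons e)
    simp only [splits, List.map_cons, List.map_map, List.sum_cons, Function.comp_def,
      List.sum_map_add, List.map_nil, List.sum_nil, add_zero, h, add_assoc]

end Splits

/-! ### The path coalgebra -/

section PathCoalgebra

variable (K : Type w) [Field K] (V : Type u) [Quiver.{v} V]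

/-- The vector space over `K` with basis the set of all paths of the quiver `V`
(vertices being the paths of length `0`). -/
def PathCoalgebra : Type (max u v w) := (Σ a b : V, Quiver.Path a b) →₀ K

instance : AddCommGroup (PathCoalgebra K V) :=
  inferInstanceAs (AddCommGroup ((Σ a b : V, Quiver.Path a b) →₀ K))

instance : Module K (PathCoalgebra K V) :=
  inferInstanceAs (Module K ((Σ a b : V, Quiver.Path a b) →₀ K))

namespace PathCoalgebra

/-- The basis of the path coalgebra indexed by the paths. -/
def basis : Module.Basis (Σ a b : V, Quiver.Path a b) K (PathCoalgebra K V) :=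
  Module.Basis.ofRepr (LinearEquiv.refl K ((Σ a b : V, Quiver.Path a b) →₀ K))

variable {V}

/-- A path, as a basis element of the path coalgebra. -/
def path {a b : V} (p : Quiver.Path a b) : PathCoalgebra K V := basis K V ⟨a, b, p⟩

variable (V)

/-- `Δ(p) = ∑ q ⊗ r` over all factorizations `p = q r`; `ε(p) = 1` if `p` has length `0`, and
`ε(p) = 0` otherwise. -/
instance : CoalgebraStruct K (PathCoalgebra K V) where
  comul := (basis K V).constr K fun p =>
    ((splits p.2.2).map fun x => path K x.2.1 ⊗ₜ[K] path K x.2.2).sum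
  counit := (basis K V).constr K fun p => if p.2.2.length = 0 then 1 else 0

variable {V}

theorem comul_path {a b : V} (p : Quiver.Path a b) :
    CoalgebraStruct.comul (R := K) (path K p) =
      ((splits p).map fun x => path K x.2.1 ⊗ₜ[K] path K x.2.2).sum :=
  (basis K V).constr_basis K _ _

theorem counit_path {a b : V} (p : Quiver.Path a b) :
    CoalgebraStruct.counit (R := K) (path K p) = if p.length = 0 then (1 : K) else 0 :=
  (basis K V).constr_basis K _ _

theorem sum_counit_left {a b : V} (p : Quiver.Path a b) :
    ((splits p).map fun x =>
      (if x.2.1.length = 0 then (1 : K) else 0) ⊗ₜ[K] path K x.2.2).sum =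
        (1 : K) ⊗ₜ[K] path K p := by
  suffices H : ∀ (M : Type (max u v w)) [AddCommGroup M] (F : ∀ c, Quiver.Path c b → M),
      ((splits p).map fun x => if x.2.1.length = 0 then F x.1 x.2.2 else 0).sum = F a p by
    have := H (K ⊗[K] PathCoalgebra K V) (fun c r => (1 : K) ⊗ₜ[K] path K r)
    rw [← this]
    congr 2
    funext x
    split_ifs <;> simp
  intro M _ F
  induction p with
  | nil => simp [splits]
  | cons p e ih =>
    simp only [splits, List.map_cons, List.map_map, List.sum_cons, Function.comp_def]
    rw [ih fun c r => F c (r.cons e)]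
    simp

theorem sum_counit_right {a b : V} (p : Quiver.Path a b) :
    ((splits p).map fun x =>
      path K x.2.1 ⊗ₜ[K] (if x.2.2.length = 0 then (1 : K) else 0)).sum =
        path K p ⊗ₜ[K] (1 : K) := by
  cases p with
  | nil => simp [splits]
  | cons p e => simp [splits, Function.comp_def]

variable (V)

instance : Coalgebra K (PathCoalgebra K V) where
  coassoc := by
    refine (basis K V).ext ?_
    rintro ⟨a, b, p⟩
    change TensorProduct.assoc K _ _ _ (LinearMap.rTensor _ CoalgebraStruct.comul
      (CoalgebraStruct.comul (path K p))) =
        LinearMap.lTensor _ CoalgebraStruct.comul (CoalgebraStruct.comul (path K p))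
    simp only [comul_path, map_list_sum, List.map_map, Function.comp_def,
      LinearMap.rTensor_tmul, LinearMap.lTensor_tmul]
    have h := sum_splits_assoc p fun c d q r s => path K q ⊗ₜ[K] (path K r ⊗ₜ[K] path K s)
    have h1 : ∀ (l : List (PathCoalgebra K V ⊗[K] PathCoalgebra K V)) (z : PathCoalgebra K V),
        l.sum ⊗ₜ[K] z = (l.map fun y => y ⊗ₜ[K] z).sum := fun l z =>
      map_list_sum ((TensorProduct.mk K _ _).flip z) l
    have h2 : ∀ (l : List (PathCoalgebra K V ⊗[K] PathCoalgebra K V)) (z : PathCoalgebra K V),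
        z ⊗ₜ[K] l.sum = (l.map fun y => z ⊗ₜ[K] y).sum := fun l z =>
      map_list_sum (TensorProduct.mk K _ _ z) l
    simpa only [h1, h2, map_list_sum, List.map_map, Function.comp_def,
      TensorProduct.assoc_tmul] using h
  rTensor_counit_comp_comul := by
    refine (basis K V).ext ?_
    rintro ⟨a, b, p⟩
    change LinearMap.rTensor _ CoalgebraStruct.counit (CoalgebraStruct.comul (path K p)) =
      (1 : K) ⊗ₜ[K] path K p
    simp only [comul_path, counit_path, map_list_sum, List.map_map, Function.comp_def,
      LinearMap.rTensor_tmul, sum_counit_left]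
  lTensor_counit_comp_comul := by
    refine (basis K V).ext ?_
    rintro ⟨a, b, p⟩
    change LinearMap.lTensor _ CoalgebraStruct.counit (CoalgebraStruct.comul (path K p)) =
      path K p ⊗ₜ[K] (1 : K)
    simp only [comul_path, counit_path, map_list_sum, List.map_map, Function.comp_def,
      LinearMap.lTensor_tmul, sum_counit_right]

end PathCoalgebra

end PathCoalgebra

/-! ### Subcoalgebras and the coradical -/

section Subcoalgebra

variable (K : Type w) [Field K] (C : Type u) [AddCommGroup C] [Module K C] [Coalgebra K C]

/-- A subcoalgebra of `C`: a subspace `D` with `Δ(D) ⊆ D ⊗ D`, where `D ⊗ D` is identified with its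
image in `C ⊗ C`. -/
structure Subcoalgebra extends Submodule K C where
  comul_mem : ∀ x ∈ toSubmodule,
    CoalgebraStruct.comul (R := K) x ∈
      LinearMap.range (TensorProduct.mapIncl toSubmodule toSubmodule)

instance : CoeSort (Subcoalgebra K C) (Type u) where
  coe D := D.toSubmodule

variable {K C}

namespace Subcoalgebra

variable (D : Subcoalgebra K C)

theorem mapIncl_injective :
    Function.Injective (TensorProduct.mapIncl D.toSubmodule D.toSubmodule) :=
  TensorProduct.map_injective_of_flat_flat _ _ D.toSubmodule.injective_subtype
    D.toSubmodule.injective_subtype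

/-- The comultiplication and counit of a subcoalgebra are the restrictions of those of `C`. -/
instance : CoalgebraStruct K D where
  comul := (LinearEquiv.ofInjective _ D.mapIncl_injective).symm.toLinearMap ∘ₗ
    (CoalgebraStruct.comul ∘ₗ D.toSubmodule.subtype).codRestrict
      (LinearMap.range (TensorProduct.mapIncl D.toSubmodule D.toSubmodule))
      (fun x => D.comul_mem x x.2)
  counit := CoalgebraStruct.counit ∘ₗ D.toSubmodule.subtype

theorem map_comul (x : D) :
    TensorProduct.map D.toSubmodule.subtype D.toSubmodule.subtype
      (CoalgebraStruct.comul (R := K) x) = CoalgebraStruct.comul (R := K) (x : C) :=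
  congrArg Subtype.val (LinearEquiv.apply_symm_apply
    (LinearEquiv.ofInjective _ D.mapIncl_injective)
    ⟨CoalgebraStruct.comul (R := K) (x : C), D.comul_mem x x.2⟩)

theorem counit_coe (x : D) :
    CoalgebraStruct.counit (R := K) x = CoalgebraStruct.counit (R := K) (x : C) := rfl

instance : Coalgebra K D where
  coassoc := by
    have hinj : Function.Injective (TensorProduct.map D.toSubmodule.subtype
        (TensorProduct.map D.toSubmodule.subtype D.toSubmodule.subtype)) :=
      TensorProduct.map_injective_of_flat_flat _ _ D.toSubmodule.injective_subtype
        D.mapIncl_injective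
    have key := D.map_comul
    set ι := D.toSubmodule.subtype with hι
    have hs : ∀ (s : D ⊗[K] D) (b : D),
        TensorProduct.map ι (TensorProduct.map ι ι) (TensorProduct.assoc K D D D (s ⊗ₜ[K] b)) =
          TensorProduct.assoc K C C C (TensorProduct.map ι ι s ⊗ₜ[K] ι b) := by
      intro s b
      induction s with
      | zero => simp
      | tmul x y => simp
      | add x y hx hy => simp only [TensorProduct.add_tmul, map_add, hx, hy]
    have hl : ∀ t : D ⊗[K] D,
        TensorProduct.map ι (TensorProduct.map ι ι) (TensorProduct.assoc K D D D
          (LinearMap.rTensor D CoalgebraStruct.comul t)) =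
        TensorProduct.assoc K C C C
          (LinearMap.rTensor C CoalgebraStruct.comul (TensorProduct.map ι ι t)) := by
      intro t
      induction t with
      | zero => simp
      | tmul x y =>
        rw [LinearMap.rTensor_tmul, hs, key, TensorProduct.map_tmul, LinearMap.rTensor_tmul]
        rfl
      | add x y hx hy => simp only [map_add, hx, hy]
    have hr : ∀ t : D ⊗[K] D,
        TensorProduct.map ι (TensorProduct.map ι ι)
          (LinearMap.lTensor D CoalgebraStruct.comul t) =
        LinearMap.lTensor C CoalgebraStruct.comul (TensorProduct.map ι ι t) := by
      intro t
      induction t with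
      | zero => simp
      | tmul x y =>
        rw [LinearMap.lTensor_tmul, TensorProduct.map_tmul, key, TensorProduct.map_tmul,
          LinearMap.lTensor_tmul]
        rfl
      | add x y hx hy => simp only [map_add, hx, hy]
    refine LinearMap.ext fun x => hinj ?_
    change TensorProduct.map ι (TensorProduct.map ι ι) (TensorProduct.assoc K D D D
        (LinearMap.rTensor D CoalgebraStruct.comul (CoalgebraStruct.comul x))) =
      TensorProduct.map ι (TensorProduct.map ι ι)
        (LinearMap.lTensor D CoalgebraStruct.comul (CoalgebraStruct.comul x))
    rw [hl, hr, key]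
    exact Coalgebra.coassoc_apply (R := K) (x : C)
  rTensor_counit_comp_comul := by
    have hinj : Function.Injective (LinearMap.lTensor K D.toSubmodule.subtype) :=
      Module.Flat.lTensor_preserves_injective_linearMap _ D.toSubmodule.injective_subtype
    have h : ∀ t : D ⊗[K] D,
        LinearMap.lTensor K D.toSubmodule.subtype
          (LinearMap.rTensor D CoalgebraStruct.counit t) =
        LinearMap.rTensor C CoalgebraStruct.counit
          (TensorProduct.map D.toSubmodule.subtype D.toSubmodule.subtype t) := by
      intro t
      induction t with
      | zero => simp
      | tmul x y => simp [counit_coe]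
      | add x y hx hy => simp only [map_add, hx, hy]
    refine LinearMap.ext fun x => hinj ?_
    rw [LinearMap.comp_apply, h, map_comul, Coalgebra.rTensor_counit_comul]
    simp
  lTensor_counit_comp_comul := by
    have hinj : Function.Injective (LinearMap.rTensor K D.toSubmodule.subtype) :=
      Module.Flat.rTensor_preserves_injective_linearMap _ D.toSubmodule.injective_subtype
    have h : ∀ t : D ⊗[K] D,
        LinearMap.rTensor K D.toSubmodule.subtype
          (LinearMap.lTensor D CoalgebraStruct.counit t) =
        LinearMap.lTensor C CoalgebraStruct.counit
          (TensorProduct.map D.toSubmodule.subtype D.toSubmodule.subtype t) := by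
      intro t
      induction t with
      | zero => simp
      | tmul x y => simp [counit_coe]
      | add x y hx hy => simp only [map_add, hx, hy]
    refine LinearMap.ext fun x => hinj ?_
    rw [LinearMap.comp_apply, h, map_comul, Coalgebra.lTensor_counit_comul]
    simp

/-- A subcoalgebra is simple if it is nonzero and its only subcoalgebras are `0` and itself.
(The subcoalgebras of `D` are the subcoalgebras of `C` contained in `D`.) -/
def IsSimple : Prop :=
  D.toSubmodule ≠ ⊥ ∧
    ∀ E : Subcoalgebra K C, E.toSubmodule ≤ D.toSubmodule →
      E.toSubmodule = ⊥ ∨ E.toSubmodule = D.toSubmodule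

end Subcoalgebra

variable (K C)

/-- The coradical `C₀` of `C`: the sum of all simple subcoalgebras of `C`. -/
def coradical : Subcoalgebra K C where
  toSubmodule := ⨆ D : {D : Subcoalgebra K C // D.IsSimple}, D.1.toSubmodule
  comul_mem := by
    intro x hx
    refine Submodule.iSup_induction _
      (motive := fun x => CoalgebraStruct.comul (R := K) x ∈ LinearMap.range _) hx ?_ ?_ ?_
    · intro D x hx
      have hle := le_iSup
        (fun D : {D : Subcoalgebra K C // D.IsSimple} => D.1.toSubmodule) D
      exact TensorProduct.range_mapIncl_mono hle hle (D.1.comul_mem x hx)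
    · rw [map_zero]; exact Submodule.zero_mem _
    · intro x y hx hy
      rw [map_add]; exact Submodule.add_mem _ hx hy

end Subcoalgebra

/-! ### The finite dual and coreflexivity -/

section Coreflexive

section FiniteDual

variable (K : Type w) [Field K] (A : Type u) [Ring A] [Algebra K A]

variable {A} in
theorem finite_quotient_iff (I : Ideal A) :
    FiniteDimensional K (A ⧸ I) ↔ (I.restrictScalars K).CoFG :=
  Module.Finite.equiv_iff (Submodule.Quotient.restrictScalarsEquiv K I).symm

variable {A} in
theorem finite_quotient_inf {I J : Ideal A} (hI : FiniteDimensional K (A ⧸ I))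
    (hJ : FiniteDimensional K (A ⧸ J)) : FiniteDimensional K (A ⧸ I ⊓ J) := by
  rw [finite_quotient_iff] at hI hJ ⊢
  have h : (I ⊓ J).restrictScalars K = I.restrictScalars K ⊓ J.restrictScalars K :=
    Submodule.ext fun _ => Iff.rfl
  rw [h]
  exact Submodule.CoFG.inf hI hJ

/-- The finite dual `A⁰` of an algebra `A`: the space of the linear functionals on `A` whose kernel
contains a two-sided ideal of finite codimension. -/
def finiteDual : Submodule K (Module.Dual K A) where
  carrier := {f | ∃ I : Ideal A, I.IsTwoSided ∧ FiniteDimensional K (A ⧸ I) ∧ ∀ x ∈ I, f x = 0}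
  zero_mem' := ⟨⊤, inferInstance, (finite_quotient_iff K ⊤).2 Submodule.CoFG.top, fun _ _ => rfl⟩
  add_mem' := by
    rintro f g ⟨I, hI, hI', hf⟩ ⟨J, hJ, hJ', hg⟩
    refine ⟨I ⊓ J, ⟨fun b hx => ⟨hI.mul_mem_of_left b hx.1, hJ.mul_mem_of_left b hx.2⟩⟩, ?_,
      fun x hx => ?_⟩
    · exact finite_quotient_inf K hI' hJ'
    · rw [LinearMap.add_apply, hf x hx.1, hg x hx.2, add_zero]
  smul_mem' := by
    rintro c f ⟨I, hI, hI', hf⟩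
    exact ⟨I, hI, hI', fun x hx => by rw [LinearMap.smul_apply, hf x hx, smul_zero]⟩

end FiniteDual

variable (K : Type w) [Field K] (C : Type u) [AddCommGroup C] [Module K C] [Coalgebra K C]

/-- The dual algebra `C*`: the dual space of `C` with the convolution product
`(f * g)(c) = ∑ f(c₁) g(c₂)` and the unit `ε`. -/
abbrev DualAlgebra : Type (max u w) := WithConv (C →ₗ[K] K)

/-- The evaluation map `C → (C*)*`, `c ↦ (f ↦ f c)`. -/
def evalDual : C →ₗ[K] Module.Dual K (DualAlgebra K C) :=
  (WithConv.linearEquiv K (C →ₗ[K] K)).toLinearMap.dualMap ∘ₗ Module.Dual.eval K C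

theorem evalDual_mem_finiteDual (c : C) : evalDual K C c ∈ finiteDual K (DualAlgebra K C) := by
  classical
  let I : Ideal (DualAlgebra K C) :=
    { carrier := {f | ∀ g h : DualAlgebra K C, (g * (f * h)) c = 0}
      zero_mem' := fun g h => by rw [zero_mul, mul_zero]; rfl
      add_mem' := fun {f f'} hf hf' g h => by
        have := congrArg₂ (· + ·) (hf g h) (hf' g h)
        rw [add_mul, mul_add]
        simpa using this
      smul_mem' := fun a f hf g h => by
        have := hf (g * a) h
        rwa [mul_assoc, ← mul_assoc a] at this }
  refine ⟨I, ⟨fun {a} b ha g h => ?_⟩, ?_, fun f hf => ?_⟩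
  · have := ha g (b * h)
    rwa [← mul_assoc a] at this
  · let r := Coalgebra.Repr.arbitrary K c
    let S : Finset C := r.index.biUnion fun i =>
      (Coalgebra.Repr.arbitrary K (r.right i)).index.image
        (Coalgebra.Repr.arbitrary K (r.right i)).left
    let ρ : DualAlgebra K C →ₗ[K] (S → K) :=
      (LinearMap.pi fun s : S => LinearMap.applyₗ (s : C)) ∘ₗ
        (WithConv.linearEquiv K (C →ₗ[K] K)).toLinearMap
    refine (finite_quotient_iff K I).2 (Submodule.CoFG.of_le ?_ (Submodule.CoFG.ker ρ))
    intro f hf g h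
    have hf' : ∀ s ∈ S, f s = 0 := fun s hs => congrFun hf ⟨s, hs⟩
    rw [r.convMul_apply]
    refine Finset.sum_eq_zero fun i hi => ?_
    rw [(Coalgebra.Repr.arbitrary K (r.right i)).convMul_apply,
      Finset.sum_eq_zero fun j hj => ?_, mul_zero]
    rw [hf' _ (Finset.mem_biUnion.2 ⟨i, hi, Finset.mem_image_of_mem _ hj⟩), zero_mul]
  · have := hf 1 1
    rwa [one_mul, mul_one] at this

/-- The natural embedding `C → (C*)⁰`. -/
def toFiniteDual : C →ₗ[K] finiteDual K (DualAlgebra K C) :=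
  (evalDual K C).codRestrict _ (evalDual_mem_finiteDual K C)

/-- `C` is coreflexive if the natural embedding `C → (C*)⁰` is an isomorphism. -/
def Coreflexive : Prop := Function.Bijective (toFiniteDual K C)

end Coreflexive

end PathCoalg

end

noncomputable section

open WithConv

namespace PathCoalg

/-! ### Coreflexivity and the dual algebra of an arbitrary coalgebra -/

section General

/-! Coreflexivity passes to any subcoalgebra, because restriction of functionals is a surjection of
dual algebras (`Subcoalgebra.coreflexive`); this gives one direction.

For the converse, let `f` vanish on a two-sided ideal `I` of finite codimension in `C*`. Functions
on the vertices give elements of `C*` supported on paths of length 0, and through them `C₀*` maps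
multiplicatively to `C*`. The preimage of `I` has finite codimension, so coreflexivity of `C₀` makes
it contain the annihilator of a finite set, which involves only a finite set `F` of vertices. Hence
`1 - e ∈ I`, where `e` is the idempotent of `F` (`exists_finite_vertexFunctional_mem`). Then `a -
eae ∈ I`, so `f a = f (eae)` for all `a`. But `eae` is `a` composed with the truncation of `C` to
paths that start and end in `F`. There are finitely many such paths, so the truncation has finite
rank and `f` is evaluation at an element of `C` (`exists_evalDual_eq`). -/

theorem evalDual_apply {K : Type*} [Field K] {C : Type*} [AddCommGroup C] [Module K C]
    (c : C) (a : DualAlgebra K C) : evalDual K C c a = a c := rfl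

/-- A functional on the dual algebra that factors through an endomorphism of finite rank is an
evaluation. -/
theorem exists_evalDual_eq {K : Type*} [Field K] {C : Type*} [AddCommGroup C] [Module K C]
    (f : Module.Dual K (DualAlgebra K C)) (P : C →ₗ[K] C)
    [FiniteDimensional K (LinearMap.range P)]
    (hf : ∀ a : DualAlgebra K C, f a = f (toConv (a.ofConv ∘ₗ P))) :
    ∃ c, evalDual K C c = f := by
  -- `g` sends `ψ` to `f (ψ ∘ P)`. The range of `P` is finite dimensional, hence reflexive, so `g`
  -- is evaluation at one of its elements.
  let g : Module.Dual K (Module.Dual K (LinearMap.range P)) :=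
    f ∘ₗ (WithConv.linearEquiv K (C →ₗ[K] K)).symm.toLinearMap ∘ₗ P.rangeRestrict.dualMap
  refine ⟨((Module.evalEquiv K (LinearMap.range P)).symm g : LinearMap.range P), ?_⟩
  ext a
  rw [evalDual_apply, hf a]
  have := Module.apply_evalEquiv_symm_apply K (LinearMap.range P)
    (a.ofConv ∘ₗ (LinearMap.range P).subtype) g
  exact this

/-- Shows that `a` and `eae` agree modulo any two-sided ideal containing `1 - e`. -/
theorem sub_mul_mul_eq {R : Type*} [Ring R] (a e : R) :
    a - e * (a * e) = (1 - e) * a + e * a * (1 - e) := by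
  noncomm_ring

variable {K : Type*} [Field K] {C : Type*} [AddCommGroup C] [Module K C] [Coalgebra K C]

theorem toFiniteDual_injective : Function.Injective (toFiniteDual K C) := by
  rw [injective_iff_map_eq_zero]
  intro c hc
  refine (Module.forall_dual_apply_eq_zero_iff K c).1 fun a => ?_
  exact LinearMap.congr_fun (congrArg Subtype.val hc) (toConv a)

/-- Only surjectivity of the natural embedding matters for coreflexivity. -/
theorem coreflexive_iff :
    Coreflexive K C ↔ ∀ f ∈ finiteDual K (DualAlgebra K C), ∃ c, evalDual K C c = f := by
  constructor
  · intro h f hf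
    obtain ⟨c, hc⟩ := h.2 ⟨f, hf⟩
    exact ⟨c, congrArg Subtype.val hc⟩
  · intro h
    refine ⟨toFiniteDual_injective, fun f => ?_⟩
    obtain ⟨c, hc⟩ := h f f.2
    exact ⟨c, Subtype.ext hc⟩

/-- The preimage of an ideal of finite codimension under a linear map has finite codimension. -/
theorem finite_quotient_comap {A B : Type*} [Ring A] [Algebra K A] [Ring B] [Algebra K B]
    {I : Ideal A} {J : Ideal B} (hI : FiniteDimensional K (A ⧸ I)) (φ : B →ₗ[K] A)
    (h : ∀ b, φ b ∈ I → b ∈ J) : FiniteDimensional K (B ⧸ J) := by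
  rw [finite_quotient_iff] at hI ⊢
  have : Module.Finite K (A ⧸ I.restrictScalars K) := hI
  refine Submodule.CoFG.of_le ?_ (Submodule.CoFG.ker ((I.restrictScalars K).mkQ ∘ₗ φ))
  intro b hb
  refine h b ?_
  simpa using hb

/-- In the dual algebra of a coreflexive coalgebra, every two-sided ideal of finite codimension
contains the annihilator of a finite set. -/
theorem Coreflexive.exists_finset (hC : Coreflexive K C) {I : Ideal (DualAlgebra K C)}
    (hI : I.IsTwoSided) (hfin : FiniteDimensional K (DualAlgebra K C ⧸ I)) :
    ∃ s : Set C, s.Finite ∧ ∀ a : DualAlgebra K C, (∀ x ∈ s, a x = 0) → a ∈ I := by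
  let b := Module.finBasis K (DualAlgebra K C ⧸ I)
  let q : DualAlgebra K C →ₗ[K] DualAlgebra K C ⧸ I := (Ideal.Quotient.mkₐ K I).toLinearMap
  have h : ∀ i, ∃ c, evalDual K C c = b.coord i ∘ₗ q := fun i =>
    coreflexive_iff.1 hC _ ⟨I, hI, hfin, fun x hx => by
      have : q x = 0 := Ideal.Quotient.eq_zero_iff_mem.2 hx
      rw [LinearMap.comp_apply, this, map_zero]⟩
  choose c hc using h
  -- Each coordinate of the class of `a` modulo `I` is the value of `a` at some `c i`, so vanishing
  -- on the `c i` forces the class to be zero.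
  refine ⟨Set.range c, Set.finite_range c, fun a ha => Ideal.Quotient.eq_zero_iff_mem.1 ?_⟩
  refine (b.forall_coord_eq_zero_iff).1 fun i => ?_
  have := LinearMap.congr_fun (hc i) a
  rw [evalDual_apply, ha _ ⟨i, rfl⟩] at this
  exact this.symm

/-- The left hit action: `c ↦ ∑ f(c₁) c₂`. -/
def hitLeft (f : DualAlgebra K C) : C →ₗ[K] C :=
  (TensorProduct.lid K C).toLinearMap ∘ₗ LinearMap.rTensor C f.ofConv ∘ₗ CoalgebraStruct.comul

/-- The right hit action: `c ↦ ∑ f(c₂) c₁`. -/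
def hitRight (f : DualAlgebra K C) : C →ₗ[K] C :=
  (TensorProduct.rid K C).toLinearMap ∘ₗ LinearMap.lTensor C f.ofConv ∘ₗ CoalgebraStruct.comul

/-- Identifies the transpose of a hit action with a convolution multiplication, so that products in
the dual algebra can be realized by endomorphisms of `C`. -/
theorem apply_hitLeft (f a : DualAlgebra K C) (c : C) : a (hitLeft f c) = (f * a) c := by
  have : ∀ t : C ⊗[K] C, a.ofConv (TensorProduct.lid K C (LinearMap.rTensor C f.ofConv t)) =
      LinearMap.mul' K K (TensorProduct.map f.ofConv a.ofConv t) := by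
    intro t
    induction t with
    | zero => simp
    | tmul x y => simp
    | add x y hx hy => simp only [map_add, hx, hy]
  exact this _

theorem apply_hitRight (f a : DualAlgebra K C) (c : C) : a (hitRight f c) = (a * f) c := by
  have : ∀ t : C ⊗[K] C, a.ofConv (TensorProduct.rid K C (LinearMap.lTensor C f.ofConv t)) =
      LinearMap.mul' K K (TensorProduct.map a.ofConv f.ofConv t) := by
    intro t
    induction t with
    | zero => simp
    | tmul x y => simp [mul_comm]
    | add x y hx hy => simp only [map_add, hx, hy]
  exact this _

/-! ### Restriction to subcoalgebras and grouplike elements -/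

namespace Subcoalgebra

variable (D : Subcoalgebra K C)

/-- Restriction of functionals to a subcoalgebra, as a homomorphism of dual algebras. -/
def restrict : DualAlgebra K C →ₐ[K] DualAlgebra K D :=
  AlgHom.ofLinearMap
    { toFun := fun a => toConv (a.ofConv ∘ₗ D.toSubmodule.subtype)
      map_add' := fun _ _ => rfl
      map_smul' := fun _ _ => rfl }
    rfl
    (fun a b => by
      ext x
      change LinearMap.mul' K K (TensorProduct.map a.ofConv b.ofConv
          (CoalgebraStruct.comul (R := K) (x : C))) =
        LinearMap.mul' K K (TensorProduct.map (a.ofConv ∘ₗ D.toSubmodule.subtype)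
          (b.ofConv ∘ₗ D.toSubmodule.subtype) (CoalgebraStruct.comul x))
      rw [TensorProduct.map_comp, LinearMap.comp_apply, map_comul])

theorem restrict_apply (a : DualAlgebra K C) (x : D) : restrict D a x = a (x : C) := rfl

theorem restrict_surjective : Function.Surjective (restrict D) := by
  intro a
  obtain ⟨b, hb⟩ := LinearMap.exists_extend a.ofConv
  exact ⟨toConv b, WithConv.ext hb⟩

theorem comul_eq_tmul_self {x : D}
    (hx : CoalgebraStruct.comul (R := K) (x : C) = (x : C) ⊗ₜ[K] (x : C)) :
    CoalgebraStruct.comul (R := K) x = x ⊗ₜ[K] x :=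
  D.mapIncl_injective ((D.map_comul x).trans hx)

/-- A subcoalgebra of a coreflexive coalgebra is coreflexive. -/
theorem coreflexive (hC : Coreflexive K C) : Coreflexive K D := by
  refine coreflexive_iff.2 ?_
  rintro f ⟨I, hI, hfin, hf⟩
  have key : f ∘ₗ (restrict D).toLinearMap ∈ finiteDual K (DualAlgebra K C) :=
    ⟨I.comap (restrict D), ⟨fun b h => by
        rw [Ideal.mem_comap, map_mul]
        exact hI.mul_mem_of_left _ h⟩,
      finite_quotient_comap hfin (restrict D).toLinearMap fun _ h => h, fun x hx => hf _ hx⟩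
  obtain ⟨c, hc⟩ := coreflexive_iff.1 hC _ key
  have hcD : c ∈ D.toSubmodule := by
    -- Otherwise some functional vanishes on `D` but not at `c`; its restriction to `D` is zero, so
    -- evaluation at `c` must kill it.
    by_contra hcD
    obtain ⟨a, hac, haD⟩ := Submodule.exists_le_ker_of_notMem hcD
    apply hac
    have h1 : a c = f (restrict D (toConv a)) := LinearMap.congr_fun hc (toConv a)
    have h2 : restrict D (toConv a) = 0 := by
      ext x
      exact haD x.2
    rw [h1, h2, map_zero]
  refine ⟨⟨c, hcD⟩, LinearMap.ext fun a => ?_⟩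
  obtain ⟨b, rfl⟩ := restrict_surjective D a
  exact LinearMap.congr_fun hc b

end Subcoalgebra

/-- The multiplicativity of functionals at a grouplike element. -/
theorem mul_apply_of_comul_eq {x : C} (hx : CoalgebraStruct.comul (R := K) x = x ⊗ₜ[K] x)
    (a b : DualAlgebra K C) : (a * b) x = a x * b x := by
  rw [LinearMap.convMul_apply, hx]
  rfl

/-- A nonzero element `x` with `Δ(x) = x ⊗ x` lies in the coradical. -/
theorem mem_coradical_of_comul_eq {x : C} (hx : CoalgebraStruct.comul (R := K) x = x ⊗ₜ[K] x)
    (h0 : x ≠ 0) : x ∈ (coradical K C).toSubmodule := by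
  let D : Subcoalgebra K C :=
    { toSubmodule := K ∙ x
      comul_mem := by
        intro y hy
        obtain ⟨c, rfl⟩ := Submodule.mem_span_singleton.1 hy
        rw [map_smul, hx]
        exact Submodule.smul_mem _ _
          ⟨⟨x, Submodule.mem_span_singleton_self x⟩ ⊗ₜ
            ⟨x, Submodule.mem_span_singleton_self x⟩, rfl⟩ }
  have hD : D.IsSimple := by
    refine ⟨fun h => h0 (Submodule.span_singleton_eq_bot.1 h), fun E hE => ?_⟩
    exact (nonzero_span_atom x h0).le_iff.1 hE
  exact le_iSup (fun D : {D : Subcoalgebra K C // D.IsSimple} => D.1.toSubmodule) ⟨D, hD⟩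
    (Submodule.mem_span_singleton_self x)

end General

/-! ### Vertex functionals and path coefficients -/

section Paths

variable {K : Type*} [Field K] {V : Type*} [Quiver V]

theorem mul_path (a b : DualAlgebra K (PathCoalgebra K V)) {u v : V} (p : Quiver.Path u v) :
    (a * b) (PathCoalgebra.path K p) = ((splits p).map fun x =>
      a (PathCoalgebra.path K x.2.1) * b (PathCoalgebra.path K x.2.2)).sum := by
  rw [LinearMap.convMul_apply, PathCoalgebra.comul_path]
  simp only [map_list_sum, List.map_map, Function.comp_def, TensorProduct.map_tmul,
    LinearMap.mul'_apply]

variable (K) in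
/-- The functional with value `g v` at each vertex `v` and `0` at all paths of positive length. -/
def vertexFunctional (g : V → K) : DualAlgebra K (PathCoalgebra K V) :=
  toConv ((PathCoalgebra.basis K V).constr K fun p => if p.2.2.length = 0 then g p.1 else 0)

theorem vertexFunctional_path (g : V → K) {u v : V} (p : Quiver.Path u v) :
    vertexFunctional K g (PathCoalgebra.path K p) = if p.length = 0 then g u else 0 :=
  (PathCoalgebra.basis K V).constr_basis K _ _

theorem dualAlgebra_ext {a b : DualAlgebra K (PathCoalgebra K V)}
    (h : ∀ (u v : V) (p : Quiver.Path u v),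
      a (PathCoalgebra.path K p) = b (PathCoalgebra.path K p)) : a = b :=
  WithConv.ext ((PathCoalgebra.basis K V).ext fun p => h p.1 p.2.1 p.2.2)

/-- Only the factorization with trivial left factor survives. This and its mirror image make vertex
functionals act diagonally on paths: by the value at the source from the left, at the target from
the right. -/
theorem sum_splits_left {M : Type*} [AddCommMonoid M] {u v : V} (p : Quiver.Path u v)
    (F : ∀ c, Quiver.Path u c → Quiver.Path c v → M)
    (hF : ∀ c q r, Quiver.Path.length q ≠ 0 → F c q r = 0) :
    ((splits p).map fun x => F x.1 x.2.1 x.2.2).sum = F u .nil p := by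
  induction p with
  | nil => simp [splits]
  | cons p e ih =>
    simp only [splits, List.map_cons, List.map_map, List.sum_cons, Function.comp_def]
    rw [ih (fun c q r => F c q (r.cons e)) fun c q r h => hF c q _ h, hF _ _ _ (by simp), zero_add]

theorem sum_splits_right {M : Type*} [AddCommMonoid M] {u v : V} (p : Quiver.Path u v)
    (F : ∀ c, Quiver.Path u c → Quiver.Path c v → M)
    (hF : ∀ c q r, Quiver.Path.length r ≠ 0 → F c q r = 0) :
    ((splits p).map fun x => F x.1 x.2.1 x.2.2).sum = F v p .nil := by
  cases p with
  | nil => simp [splits]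
  | cons p e =>
    simp only [splits, List.map_cons, List.map_map, List.sum_cons, Function.comp_def]
    rw [List.sum_eq_zero, add_zero]
    intro y hy
    obtain ⟨x, -, rfl⟩ := List.mem_map.1 hy
    exact hF _ _ _ (by simp)

theorem vertexFunctional_mul_path (g : V → K) (a : DualAlgebra K (PathCoalgebra K V)) {u v : V}
    (p : Quiver.Path u v) : (vertexFunctional K g * a) (PathCoalgebra.path K p) =
      g u * a (PathCoalgebra.path K p) := by
  rw [mul_path, sum_splits_left p fun c q r =>
    vertexFunctional K g (PathCoalgebra.path K q) * a (PathCoalgebra.path K r)]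
  · simp [vertexFunctional_path]
  · intro c q r h
    simp [vertexFunctional_path, h]

theorem mul_vertexFunctional_path (g : V → K) (a : DualAlgebra K (PathCoalgebra K V)) {u v : V}
    (p : Quiver.Path u v) : (a * vertexFunctional K g) (PathCoalgebra.path K p) =
      a (PathCoalgebra.path K p) * g v := by
  rw [mul_path, sum_splits_right p fun c q r =>
    a (PathCoalgebra.path K q) * vertexFunctional K g (PathCoalgebra.path K r)]
  · simp [vertexFunctional_path]
  · intro c q r h
    simp [vertexFunctional_path, h]

theorem vertexFunctional_mul (g h : V → K) :
    vertexFunctional K (g * h) = vertexFunctional K g * vertexFunctional K h := by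
  refine dualAlgebra_ext fun u v p => ?_
  rw [vertexFunctional_mul_path, vertexFunctional_path, vertexFunctional_path]
  split_ifs <;> simp

theorem vertexFunctional_one : vertexFunctional K (1 : V → K) = 1 := by
  refine dualAlgebra_ext fun u v p => ?_
  rw [vertexFunctional_path, LinearMap.convOne_apply, PathCoalgebra.counit_path]
  rfl

variable (K) in
/-- `vertexFunctional` as a homomorphism of algebras. -/
def vertexFunctionalHom : (V → K) →ₐ[K] DualAlgebra K (PathCoalgebra K V) :=
  AlgHom.ofLinearMap
    { toFun := vertexFunctional K
      map_add' := fun g h => dualAlgebra_ext fun u v p => by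
        change _ = vertexFunctional K g (PathCoalgebra.path K p) +
          vertexFunctional K h (PathCoalgebra.path K p)
        simp only [vertexFunctional_path]
        split_ifs <;> simp
      map_smul' := fun c g => dualAlgebra_ext fun u v p => by
        change _ = c * vertexFunctional K g (PathCoalgebra.path K p)
        simp only [vertexFunctional_path]
        split_ifs <;> simp }
    vertexFunctional_one vertexFunctional_mul

theorem vertexFunctionalHom_apply (g : V → K) : vertexFunctionalHom K g = vertexFunctional K g :=
  rfl

/-- The coefficient of a path, as an element of the dual algebra. -/
def coeff (p : Σ a b : V, Quiver.Path a b) : DualAlgebra K (PathCoalgebra K V) :=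
  toConv ((PathCoalgebra.basis K V).coord p)

theorem coeff_path (p : Σ a b : V, Quiver.Path a b) {u v : V} (q : Quiver.Path u v)
    [Decidable ((⟨u, v, q⟩ : Σ a b : V, Quiver.Path a b) = p)] :
    coeff (K := K) p (PathCoalgebra.path K q) = if ⟨u, v, q⟩ = p then 1 else 0 := by
  classical
  change (PathCoalgebra.basis K V).repr (PathCoalgebra.basis K V ⟨u, v, q⟩) p = _
  rw [Module.Basis.repr_self, Finsupp.single_apply]

theorem ext_coeff {x y : PathCoalgebra K V} (h : ∀ p, coeff (K := K) p x = coeff p y) : x = y :=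
  (PathCoalgebra.basis K V).ext_elem h

theorem vertexFunctional_mul_coeff_mul (g h : V → K) (p : Σ a b : V, Quiver.Path a b) :
    vertexFunctional K g * (coeff p * vertexFunctional K h) = (g p.1 * h p.2.1) • coeff p := by
  classical
  refine dualAlgebra_ext fun u v q => ?_
  rw [vertexFunctional_mul_path, mul_vertexFunctional_path]
  change _ = (g p.1 * h p.2.1) * coeff p (PathCoalgebra.path K q)
  rw [coeff_path]
  split_ifs with hq
  · subst hq
    ring
  · simp

/-- If there are only finitely many closed paths at `v`, then there is only the trivial one. -/
theorem path_eq_nil {v : V} [Finite (Quiver.Path v v)] (p : Quiver.Path v v) : p = .nil := by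
  by_contra hp
  have hpos : p.length ≠ 0 := fun h => hp (Quiver.Path.eq_nil_of_length_zero p h)
  -- The powers of a nontrivial closed path have distinct lengths, so there would be infinitely many
  -- closed paths.
  let f : ℕ → Quiver.Path v v := fun n => n.rec .nil fun _ q => q.comp p
  have hf : ∀ n, (f n).length = n * p.length := by
    intro n
    induction n with
    | zero => simp [f]
    | succ n ih =>
      have : f (n + 1) = (f n).comp p := rfl
      rw [this, Quiver.Path.length_comp, ih, Nat.succ_mul]
  refine not_injective_infinite_finite f fun m n h => ?_
  have := congrArg Quiver.Path.length h
  rw [hf, hf] at this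
  exact Nat.eq_of_mul_eq_mul_right (Nat.pos_of_ne_zero hpos) this

/-! ### Truncation of a subcoalgebra to prescribed endpoints -/

variable (C : Subcoalgebra K (PathCoalgebra K V))

/-- The part of an element of `C` supported on the paths `p : u ⟶ v`, where each coefficient
is multiplied by `g u * h v`. -/
def truncate (g h : V → K) : C →ₗ[K] C :=
  hitRight (C.restrict (vertexFunctional K h)) ∘ₗ hitLeft (C.restrict (vertexFunctional K g))

theorem apply_truncate (g h : V → K) (a : DualAlgebra K C) (c : C) :
    a (truncate C g h c) =
      (C.restrict (vertexFunctional K g) * (a * C.restrict (vertexFunctional K h))) c := by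
  rw [← apply_hitLeft, ← apply_hitRight]
  rfl

/-- The transpose of truncation is two-sided multiplication by vertex functionals, and each
coefficient functional is an eigenvector of it. -/
theorem coeff_truncate (g h : V → K) (p : Σ a b : V, Quiver.Path a b) (c : C) :
    coeff (K := K) p (truncate C g h c : PathCoalgebra K V) =
      g p.1 * h p.2.1 * coeff (K := K) p (c : PathCoalgebra K V) := by
  rw [← C.restrict_apply, apply_truncate, ← map_mul, ← map_mul, vertexFunctional_mul_coeff_mul]
  rfl

theorem finiteDimensional_range_truncate (hfin : ∀ a b : V, Finite (Quiver.Path a b))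
    {g h : V → K} (hg : g.support.Finite) (hh : h.support.Finite) :
    FiniteDimensional K (LinearMap.range (truncate C g h)) := by
  have := hg.to_subtype
  have := hh.to_subtype
  -- The finitely many paths from the support of `g` to that of `h`; all other coefficients of a
  -- truncated element vanish.
  let T := Σ (a : g.support) (b : h.support), Quiver.Path a.1 b.1
  let ι : T → Σ a b : V, Quiver.Path a b := fun t => ⟨t.1, t.2.1, t.2.2⟩
  let L : C →ₗ[K] (T → K) := LinearMap.pi fun t =>
    (coeff (K := K) (ι t)).ofConv ∘ₗ C.toSubmodule.subtype
  refine FiniteDimensional.of_injective (L ∘ₗ (LinearMap.range (truncate C g h)).subtype) ?_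
  rw [injective_iff_map_eq_zero]
  rintro ⟨_, ⟨c, rfl⟩⟩ hx
  refine Subtype.ext (Subtype.ext (ext_coeff fun p => ?_))
  change _ = (coeff (K := K) p).ofConv 0
  rw [map_zero]
  obtain ⟨a, b, p⟩ := p
  by_cases ha : g a = 0
  · exact (coeff_truncate C g h ⟨a, b, p⟩ c).trans (by simp [ha])
  by_cases hb : h b = 0
  · exact (coeff_truncate C g h ⟨a, b, p⟩ c).trans (by simp [hb])
  exact congrFun hx ⟨⟨a, ha⟩, ⟨b, hb⟩, p⟩

theorem comul_nil (v : V) : CoalgebraStruct.comul (R := K)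
    (PathCoalgebra.path K (.nil : Quiver.Path v v)) =
      PathCoalgebra.path K (.nil : Quiver.Path v v) ⊗ₜ[K]
        PathCoalgebra.path K (.nil : Quiver.Path v v) := by
  simp [PathCoalgebra.comul_path, splits]

/-- A vertex occurring in an element of `C` belongs to `C`. -/
theorem nil_mem {v : V} [Finite (Quiver.Path v v)] (c : C)
    (hc : coeff (K := K) ⟨v, v, .nil⟩ (c : PathCoalgebra K V) ≠ 0) :
    PathCoalgebra.path K (.nil : Quiver.Path v v) ∈ C.toSubmodule := by
  classical
  -- Truncation at `v` on both ends stays in `C` and keeps only closed paths at `v`; by finiteness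
  -- the trivial path is the only one.
  suffices h : (truncate C (Pi.single v 1) (Pi.single v 1) c : PathCoalgebra K V) =
      coeff (K := K) ⟨v, v, .nil⟩ (c : PathCoalgebra K V) •
        PathCoalgebra.path K (.nil : Quiver.Path v v) by
    have := (truncate C (Pi.single v 1) (Pi.single v 1) c).2
    rw [h] at this
    exact (Submodule.smul_mem_iff _ hc).1 this
  refine ext_coeff fun p => ?_
  rw [coeff_truncate, map_smul, coeff_path, smul_eq_mul]
  obtain ⟨a, b, p⟩ := p
  by_cases ha : a = v
  · by_cases hb : b = v
    · subst ha hb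
      simp [path_eq_nil p]
    · have : (⟨v, v, .nil⟩ : Σ a b : V, Quiver.Path a b) ≠ ⟨a, b, p⟩ := by
        rintro h
        subst ha
        simp only [Sigma.mk.injEq, heq_eq_eq, true_and] at h
        exact hb h.1.symm
      simp [this, hb]
  · have : (⟨v, v, .nil⟩ : Σ a b : V, Quiver.Path a b) ≠ ⟨a, b, p⟩ := by
      rintro h
      simp only [Sigma.mk.injEq] at h
      exact ha h.1.symm
    simp [this, ha]

/-! ### Vertices of `C` and the passage from the coradical to `C` -/

theorem vertexFunctional_eq_sum (g : V → K) (x : PathCoalgebra K V) :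
    vertexFunctional K g x = ((PathCoalgebra.basis K V).repr x).sum fun p k =>
      k * if p.2.2.length = 0 then g p.1 else 0 := by
  change (PathCoalgebra.basis K V).constr K _ x = _
  rw [Module.Basis.constr_apply]
  rfl

theorem vertexFunctional_congr {g h : V → K} (x : PathCoalgebra K V)
    (H : ∀ v, coeff (K := K) ⟨v, v, .nil⟩ x ≠ 0 → g v = h v) :
    vertexFunctional K g x = vertexFunctional K h x := by
  rw [vertexFunctional_eq_sum, vertexFunctional_eq_sum]
  refine Finsupp.sum_congr fun p hp => ?_
  obtain ⟨a, b, p⟩ := p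
  split_ifs with h0
  · have hab := Quiver.Path.eq_of_length_zero p h0
    subst hab
    have := Quiver.Path.eq_nil_of_length_zero p h0
    subst this
    rw [H a (Finsupp.mem_support_iff.1 hp)]
  · rfl

/-- The vertices belonging to `C`, as elements of the coradical of `C`. -/
theorem nil_mem_coradical {v : V}
    (hv : PathCoalgebra.path K (.nil : Quiver.Path v v) ∈ C.toSubmodule) :
    (⟨PathCoalgebra.path K .nil, hv⟩ : C) ∈ (coradical K C).toSubmodule := by
  refine mem_coradical_of_comul_eq (C.comul_eq_tmul_self (comul_nil v)) fun h => ?_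
  exact (PathCoalgebra.basis K V).ne_zero ⟨v, v, .nil⟩ (congrArg Subtype.val h)

open Classical in
/-- The values of a functional on the coradical at the vertices of `C`, extended by zero. -/
def vertexValue : DualAlgebra K (coradical K C) →ₗ[K] (V → K) where
  toFun a v := if hv : PathCoalgebra.path K (.nil : Quiver.Path v v) ∈ C.toSubmodule then
    a ⟨⟨_, hv⟩, nil_mem_coradical C hv⟩ else 0
  map_add' a b := by
    funext v
    simp only [Pi.add_apply]
    split_ifs
    · rfl
    · simp
  map_smul' k a := by
    funext v
    simp only [Pi.smul_apply, RingHom.id_apply]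
    split_ifs
    · rfl
    · simp

theorem vertexValue_of_mem (a : DualAlgebra K (coradical K C)) {v : V}
    (hv : PathCoalgebra.path K (.nil : Quiver.Path v v) ∈ C.toSubmodule) :
    vertexValue C a v = a ⟨⟨_, hv⟩, nil_mem_coradical C hv⟩ :=
  dif_pos hv

theorem vertexValue_mul (a b : DualAlgebra K (coradical K C)) :
    vertexValue C (a * b) = vertexValue C a * vertexValue C b := by
  funext v
  rw [Pi.mul_apply]
  by_cases hv : PathCoalgebra.path K (.nil : Quiver.Path v v) ∈ C.toSubmodule
  · have h1 : CoalgebraStruct.comul (R := K) (⟨_, hv⟩ : C) = ⟨_, hv⟩ ⊗ₜ[K] ⟨_, hv⟩ :=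
      C.comul_eq_tmul_self (x := ⟨_, hv⟩) (comul_nil v)
    have h2 := (coradical K C).comul_eq_tmul_self (x := ⟨⟨_, hv⟩, nil_mem_coradical C hv⟩) h1
    rw [vertexValue_of_mem C _ hv, vertexValue_of_mem C _ hv, vertexValue_of_mem C _ hv]
    exact mul_apply_of_comul_eq h2 a b
  · simp [vertexValue, hv]

/-- If the coradical of `C` is coreflexive, then modulo a two-sided ideal of finite codimension in
the dual algebra of `C`, the unit is the sum of finitely many vertex idempotents. -/
theorem exists_finite_vertexFunctional_mem (hfin : ∀ a b : V, Finite (Quiver.Path a b))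
    (hC : Coreflexive K (coradical K C)) {I : Ideal (DualAlgebra K C)} (hI : I.IsTwoSided)
    (hI' : FiniteDimensional K (DualAlgebra K C ⧸ I)) :
    ∃ g : V → K, g.support.Finite ∧ 1 - C.restrict (vertexFunctional K g) ∈ I := by
  classical
  -- Read off the values at the vertices of `C` and extend by zero to paths of positive length.
  -- Multiplicativity of `φ` makes the preimage of `I` a two-sided ideal.
  let φ : DualAlgebra K (coradical K C) →ₗ[K] DualAlgebra K C :=
    (C.restrict.comp (vertexFunctionalHom K)).toLinearMap ∘ₗ vertexValue C
  have hφ : ∀ a b, φ (a * b) = φ a * φ b := fun a b => by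
    simp only [φ, LinearMap.comp_apply, vertexValue_mul, AlgHom.toLinearMap_apply, map_mul]
  let J : Ideal (DualAlgebra K (coradical K C)) :=
    { carrier := {a | φ a ∈ I}
      zero_mem' := by
        rw [Set.mem_ofPred_eq, map_zero]
        exact I.zero_mem
      add_mem' := fun {a b} ha hb => by
        rw [Set.mem_ofPred_eq, map_add]
        exact I.add_mem ha hb
      smul_mem' := fun a b hb => by
        rw [Set.mem_ofPred_eq, smul_eq_mul, hφ]
        exact I.mul_mem_left _ hb }
  have hJ : J.IsTwoSided := ⟨fun {a} b ha => by
    change φ (a * b) ∈ I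
    rw [hφ]
    exact hI.mul_mem_of_left _ ha⟩
  obtain ⟨s, hs, hsJ⟩ := hC.exists_finset hJ (finite_quotient_comap hI' φ fun _ h => h)
  -- All vertices occurring in the finite set `s`. A vertex functional vanishing on `F` therefore
  -- vanishes on `s`, so its restriction to the coradical lies in `J`.
  let F : Set V := ⋃ x ∈ s, {v | coeff (K := K) ⟨v, v, .nil⟩ (x : PathCoalgebra K V) ≠ 0}
  have hF : F.Finite := by
    refine hs.biUnion fun x _ => ?_
    refine Set.Finite.of_injOn (f := fun v : V => (⟨v, v, .nil⟩ : Σ a b : V, Quiver.Path a b))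
      (fun v hv => Finsupp.mem_support_iff.2 hv) (fun u _ v _ h => congrArg Sigma.fst h)
      (((PathCoalgebra.basis K V).repr (x : PathCoalgebra K V)).support.finite_toSet)
  refine ⟨F.indicator 1, hF.subset Set.support_indicator_subset, ?_⟩
  let x : DualAlgebra K (coradical K C) :=
    (coradical K C).restrict (C.restrict (vertexFunctional K (1 - F.indicator 1)))
  have hx : x ∈ J := by
    refine hsJ x fun y hy => ?_
    change vertexFunctional K (1 - F.indicator 1) (y : PathCoalgebra K V) = 0
    rw [vertexFunctional_congr (h := 0)]
    · rw [← vertexFunctionalHom_apply, map_zero]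
      rfl
    · intro v hv
      have : v ∈ F := Set.mem_biUnion hy hv
      simp [this]
  -- The extension by zero in `vertexValue` is harmless: by `nil_mem`, any vertex occurring in an
  -- element of `C` belongs to `C`, and there both sides take the same value.
  have hxφ : φ x = 1 - C.restrict (vertexFunctional K (F.indicator 1)) := by
    rw [← map_one C.restrict, ← vertexFunctional_one, ← map_sub, ← vertexFunctionalHom_apply,
      ← vertexFunctionalHom_apply, ← map_sub]
    ext c
    change vertexFunctional K (vertexValue C x) (c : PathCoalgebra K V) =
      vertexFunctional K (1 - F.indicator 1) (c : PathCoalgebra K V)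
    refine vertexFunctional_congr _ fun v hv => ?_
    rw [vertexValue_of_mem C x (nil_mem C c hv)]
    change vertexFunctional K (1 - F.indicator 1) (PathCoalgebra.path K .nil) = _
    simp [vertexFunctional_path]
  rw [← hxφ]
  exact hx

theorem coreflexive_of_coreflexive_coradical (hfin : ∀ a b : V, Finite (Quiver.Path a b))
    (hC : Coreflexive K (coradical K C)) : Coreflexive K C := by
  refine coreflexive_iff.2 ?_
  rintro f ⟨I, hI, hI', hf⟩
  obtain ⟨g, hg, hgI⟩ := exists_finite_vertexFunctional_mem C hfin hC hI hI'
  have := finiteDimensional_range_truncate C hfin hg hg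
  refine exists_evalDual_eq f (truncate C g g) fun a => ?_
  set e := C.restrict (vertexFunctional K g)
  have h : toConv (a.ofConv ∘ₗ truncate C g g) = e * (a * e) := by
    ext c
    exact apply_truncate C g g a c
  rw [h, ← sub_eq_zero, ← map_sub]
  refine hf _ ?_
  -- Both summands of `a - eae` contain the factor `1 - e`, which lies in `I`.
  rw [sub_mul_mul_eq]
  exact I.add_mem (hI.mul_mem_of_left _ hgI) (I.mul_mem_left _ hgI)

end Paths

end PathCoalg

end

theorem proposition5p4 {K : Type*} [Field K] {V : Type*} [Quiver V]
    (hfin : ∀ a b : V, Finite (Quiver.Path a b))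
    (C : PathCoalg.Subcoalgebra K (PathCoalg.PathCoalgebra K V)) :
    PathCoalg.Coreflexive K C ↔ PathCoalg.Coreflexive K (PathCoalg.coradical K C) :=
  ⟨(PathCoalg.coradical K C).coreflexive,
    PathCoalg.coreflexive_of_coreflexive_coradical C hfin⟩
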